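/- Let $\mathbb{H}^2=\{x+iy\in\mathbb{C}: y>0\}$ and let $\widetilde M_2=\{(z_1,z_2)\in\mathbb{H}^2\times\mathbb{H}^2 : z_1\ne z_2\}$, with the complex structure it has as an open subset of $\mathbb{C}^2$ (it is the double cover of the space of two distinct unordered points of $\mathbb{H}^2$). Let $PL(2,\mathbb{R})=\{[M]: M \text{ a real } 2\times 2 \text{ matrix},\ \det M>0\}=SL(2,\mathbb{R})/\{\pm 1\}$ act on $\mathbb{H}^2$ by $M\odot z=\frac{az+b}{cz+d}$, $M=\begin{pmatrix}a&b\\c&d\end{pmatrix}$, and on $\widetilde M_2$ by $(z_1,z_2)\mapsto(M\odot z_1,M\odot z_2)$. For $s>0$ put $w_s=(ie^{s/2},ie^{-s/2})$; the map $(s,g)\mapsto g\odot w_s$ identifies $(0,\infty)\times PL(2,\mathbb{R})$ with $\widetilde M_2$, and $s$ is the distance between the two points in the metric $(dx^2+dy^2)/y^2$. On $\widetilde M_2$ consider the coframe $ds,\sigma_1,\sigma_2,\sigma_3$, where $\sigma_1,\sigma_2,\sigma_3$ are the left-invariant $1$-forms on $PL(2,\mathbb{R})$ dual to the basis $$e_1=\begin{pmatrix}0&1\\1&0\end{pmatrix},\qquad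 e_2=\begin{pmatrix}0&1\\-1&0\end{pmatrix},\qquad e_3=\begin{pmatrix}1&0\\0&-1\end{pmatrix}$$ of its Lie algebra. Let $\tilde\gamma$ be a Kähler metric on $\widetilde M_2$ that is invariant under $PL(2,\mathbb{R})$ and under the swap $(z_1,z_2)\mapsto(z_2,z_1)$. Then there exists a smooth function $A:(0,\infty)\to\mathbb{R}$ such that $$\tilde\gamma=A_1(s)\,ds^2+A_2(s)\,\sigma_1^2+A_3(s)\,\sigma_2^2+A_4(s)\,\sigma_3^2,$$ where $$A_1=\frac{1}{8\sinh(s/2)}\frac{d}{ds}\left(\frac{A(s)}{\cosh(s/2)}\right),\qquad A_2=A(s),$$ $$A_3=2\sinh(s/2)\,\frac{d}{ds}\left(\frac{A(s)}{\cosh(s/2)}\right),\qquad A_4=\frac{A(s)}{\cosh^2(s/2)}.$$ -/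

import Mathlib

open Set
open scoped ContDiff

namespace TwoVortex

noncomputable section

/-- The double cover `{(z₁, z₂) ∈ ℍ × ℍ : z₁ ≠ z₂}` of the space of two distinct unordered points
of the hyperbolic plane `ℍ = {x + i y : y > 0}`, an open subset of `ℂ × ℂ`. -/
def space : Set (ℂ × ℂ) := {p | 0 < p.1.im ∧ 0 < p.2.im ∧ p.1 ≠ p.2}

/-- The fractional linear transformation `z ↦ (a z + b) / (c z + d)`. -/
def mobius (M : Matrix (Fin 2) (Fin 2) ℝ) (z : ℂ) : ℂ :=
  (M 0 0 * z + M 0 1) / (M 1 0 * z + M 1 1)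

/-- The diagonal action `(z₁, z₂) ↦ (M ⊙ z₁, M ⊙ z₂)`. -/
def act (M : Matrix (Fin 2) (Fin 2) ℝ) (p : ℂ × ℂ) : ℂ × ℂ := (mobius M p.1, mobius M p.2)

/-! ### Kähler metrics and their symmetries

A symmetric `(0,2)` tensor on `space` is a map `γ` that sends a point of `ℂ × ℂ` to a real bilinear
form on the tangent space `ℂ × ℂ`; only its values on `space` matter. The complex structure `J` is
multiplication by `i`. -/

/-- `γ` is a Kähler metric on `space`: a smooth Riemannian metric that is Hermitian and whose
Kähler form `Ω(u, v) = γ(J u, v)` is a closed (smooth) 2-form. -/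
structure IsKahlerMetric (γ : ℂ × ℂ → (ℂ × ℂ →L[ℝ] ℂ × ℂ →L[ℝ] ℝ)) : Prop where
  smooth : ContDiffOn ℝ ∞ γ space
  symm : ∀ p ∈ space, ∀ u v, γ p u v = γ p v u
  pos : ∀ p ∈ space, ∀ u, u ≠ 0 → 0 < γ p u u
  hermitian : ∀ p ∈ space, ∀ u v, γ p (Complex.I • u) (Complex.I • v) = γ p u v
  closed : ∃ Ω : ℂ × ℂ → (ℂ × ℂ) [⋀^Fin 2]→L[ℝ] ℝ,
    (∀ p ∈ space, ∀ u v, Ω p ![u, v] = γ p (Complex.I • u) v) ∧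
    ContDiffOn ℝ ∞ Ω space ∧ ∀ p ∈ space, extDeriv Ω p = 0

/-- Invariance `φ_g^* γ = γ` under the action of the projective group
`{[M] : M real 2 × 2, det M > 0} = SL(2, ℝ) / {± 1}`, each element being represented by a matrix
of determinant one. -/
def IsMobiusInvariant (γ : ℂ × ℂ → (ℂ × ℂ →L[ℝ] ℂ × ℂ →L[ℝ] ℝ)) : Prop :=
  ∀ g : Matrix.SpecialLinearGroup (Fin 2) ℝ, ∀ p ∈ space, ∀ u v,
    γ (act g.1 p) (fderiv ℝ (act g.1) p u) (fderiv ℝ (act g.1) p v) = γ p u v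

/-- Invariance under the isometry `(z₁, z₂) ↦ (z₂, z₁)`. -/
def IsSwapInvariant (γ : ℂ × ℂ → (ℂ × ℂ →L[ℝ] ℂ × ℂ →L[ℝ] ℝ)) : Prop :=
  ∀ p ∈ space, ∀ u v, γ p.swap u.swap v.swap = γ p u v

/-! ### The coordinates `(s, g)` and the coframe `ds, σ₁, σ₂, σ₃` -/

/-- The point `w_s = (i e^{s/2}, i e^{-s/2})`. -/
def basePoint (s : ℝ) : ℂ × ℂ :=
  (Complex.I * Real.exp (s / 2), Complex.I * Real.exp (-s / 2))

/-- The basis `e₁, e₂, e₃` (with indices `0, 1, 2`) of the Lie algebra. -/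
def e : Fin 3 → Matrix (Fin 2) (Fin 2) ℝ :=
  ![!![0, 1; 1, 0], !![0, 1; -1, 0], !![1, 0; 0, -1]]

/-- The value at `g ⊙ w_s` of the coordinate field `∂/∂s` of the parametrization
`(s, g) ↦ g ⊙ w_s`. -/
def fieldS (s : ℝ) (g : Matrix.SpecialLinearGroup (Fin 2) ℝ) : ℂ × ℂ :=
  deriv (fun t : ℝ => act g.1 (basePoint t)) s

/-- The value at `g ⊙ w_s` of the image under `(s, g) ↦ g ⊙ w_s` of the left-invariant vector field
`g ↦ g e_k`. -/
def fieldE (k : Fin 3) (s : ℝ) (g : Matrix.SpecialLinearGroup (Fin 2) ℝ) : ℂ × ℂ :=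
  deriv (fun t : ℝ => act (g.1 * (1 + t • e k)) (basePoint s)) 0

/-- The coordinate `s`: the distance between the two points with respect to the metric
`(dx² + dy²) / y²`, so that `w_s` has coordinate `s`. -/
def sep (p : ℂ × ℂ) : ℝ :=
  2 * Real.arsinh (‖p.1 - p.2‖ / (2 * Real.sqrt (p.1.im * p.2.im)))

/-- The 1-form `ds`. -/
def ds (p : ℂ × ℂ) : ℂ × ℂ →L[ℝ] ℝ := fderiv ℝ sep p

/-- The property that characterizes the value of `σ_k` at `p`: whenever `p = g ⊙ w_s`, it is dual to
the left-invariant fields `e₁, e₂, e₃` and vanishes on `∂/∂s`. -/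
def IsSigma (k : Fin 3) (p : ℂ × ℂ) (α : ℂ × ℂ →L[ℝ] ℝ) : Prop :=
  ∀ s : ℝ, 0 < s → ∀ g : Matrix.SpecialLinearGroup (Fin 2) ℝ, act g.1 (basePoint s) = p →
    α (fieldS s g) = 0 ∧ ∀ j, α (fieldE j s g) = if j = k then 1 else 0

/-! Existence and uniqueness of the coframe. -/

theorem mobius_coe (g : Matrix.SpecialLinearGroup (Fin 2) ℝ) (z : UpperHalfPlane) :
    mobius g.1 z = ((g • z : UpperHalfPlane) : ℂ) := by
  rw [UpperHalfPlane.coe_specialLinearGroup_apply]; rfl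

theorem det_eq (g : Matrix.SpecialLinearGroup (Fin 2) ℝ) :
    g.1 0 0 * g.1 1 1 - g.1 0 1 * g.1 1 0 = 1 := by
  have := g.2; rwa [Matrix.det_fin_two] at this

theorem denom_ne (M : Matrix (Fin 2) (Fin 2) ℝ) (hM : 0 < M.det) (z : ℂ) (hz : 0 < z.im) :
    (M 1 0 : ℂ) * z + M 1 1 ≠ 0 := by
  intro h
  have h1 := congrArg Complex.im h
  have h2 := congrArg Complex.re h
  simp at h1 h2
  rw [Matrix.det_fin_two] at hM
  rcases h1 with h1 | h1
  · simp [h1] at h2; simp [h1, h2] at hM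
  · exact hz.ne' h1

theorem basePoint_mem (s : ℝ) (hs : 0 < s) : basePoint s ∈ space := by
  refine ⟨?_, ?_, ?_⟩
  · simp [basePoint, -Complex.ofReal_exp]; positivity
  · simp [basePoint, -Complex.ofReal_exp]; positivity
  · intro h
    have := congrArg Complex.im h
    simp [basePoint, -Complex.ofReal_exp] at this
    linarith

/-- The differential of `g` at `(z₁, z₂)`: multiplication by `(c z_j + d)⁻²`. -/
theorem hasDerivAt_mobius (g : Matrix.SpecialLinearGroup (Fin 2) ℝ) (z : ℂ) (hz : 0 < z.im) :
    HasDerivAt (mobius g.1) (1 / ((g.1 1 0 : ℂ) * z + g.1 1 1) ^ 2) z := by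
  have hd := denom_ne g.1 (by rw [g.2]; exact one_pos) z hz
  have h1 : HasDerivAt (fun z : ℂ => (g.1 0 0 : ℂ) * z + g.1 0 1) (g.1 0 0 : ℂ) z := by
    simpa using ((hasDerivAt_id z).const_mul (g.1 0 0 : ℂ)).add_const (g.1 0 1 : ℂ)
  have h2 : HasDerivAt (fun z : ℂ => (g.1 1 0 : ℂ) * z + g.1 1 1) (g.1 1 0 : ℂ) z := by
    simpa using ((hasDerivAt_id z).const_mul (g.1 1 0 : ℂ)).add_const (g.1 1 1 : ℂ)
  convert! h1.div h2 hd using 1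
  congr 1
  have := congrArg (fun x : ℝ => (x : ℂ)) (det_eq g)
  push_cast at this
  linear_combination -this

theorem hasDerivAt_curveS (s : ℝ) (g : Matrix.SpecialLinearGroup (Fin 2) ℝ) :
    HasDerivAt (fun t : ℝ => act g.1 (basePoint t))
      (1 / ((g.1 1 0 : ℂ) * (basePoint s).1 + g.1 1 1) ^ 2 *
          (Complex.I * (Real.exp (s / 2) / 2 : ℝ)),
        1 / ((g.1 1 0 : ℂ) * (basePoint s).2 + g.1 1 1) ^ 2 *
          (Complex.I * (-Real.exp (-s / 2) / 2 : ℝ))) s := by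
  have a1 : HasDerivAt (fun t : ℝ => Real.exp (t / 2)) (Real.exp (s / 2) / 2) s := by
    simpa [div_eq_mul_inv] using ((hasDerivAt_id s).div_const 2).exp
  have a2 : HasDerivAt (fun t : ℝ => Real.exp (-t / 2)) (-Real.exp (-s / 2) / 2) s := by
    convert! ((hasDerivAt_id s).neg.div_const 2).exp using 1
    simp; ring
  have b1 := a1.ofReal_comp.const_mul Complex.I
  have b2 := a2.ofReal_comp.const_mul Complex.I
  have i1 : 0 < (basePoint s).1.im := by
    simp [basePoint, -Complex.ofReal_exp]; positivity
  have i2 : 0 < (basePoint s).2.im := by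
    simp [basePoint, -Complex.ofReal_exp]; positivity
  exact ((hasDerivAt_mobius g _ i1).comp s b1).prodMk ((hasDerivAt_mobius g _ i2).comp s b2)

/-- The infinitesimal action of `X` at `z`. -/
def inf (X : Matrix (Fin 2) (Fin 2) ℝ) (z : ℂ) : ℂ :=
  X 0 1 + (X 0 0 - X 1 1) * z - X 1 0 * z ^ 2

theorem hasDerivAt_curve (X : Matrix (Fin 2) (Fin 2) ℝ)
    (g : Matrix.SpecialLinearGroup (Fin 2) ℝ) (z : ℂ) (hz : 0 < z.im) :
    HasDerivAt (fun t : ℝ => mobius (g.1 * (1 + t • X)) z)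
      (1 / ((g.1 1 0 : ℂ) * z + g.1 1 1) ^ 2 * inf X z) 0 := by
  have hd := denom_ne g.1 (by rw [g.2]; exact one_pos) z hz
  have key : ∀ a b : ℂ, HasDerivAt (fun t : ℝ => a + t * b) b 0 := fun a b => by
    simpa using ((hasDerivAt_id (0 : ℝ)).ofReal_comp.mul_const b).const_add a
  have h := (key ((g.1 0 0 : ℂ) * z + g.1 0 1)
      (((g.1 0 0 : ℂ) * X 0 0 + g.1 0 1 * X 1 0) * z + ((g.1 0 0 : ℂ) * X 0 1 + g.1 0 1 * X 1 1))).div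
    (key ((g.1 1 0 : ℂ) * z + g.1 1 1)
      (((g.1 1 0 : ℂ) * X 0 0 + g.1 1 1 * X 1 0) * z + ((g.1 1 0 : ℂ) * X 0 1 + g.1 1 1 * X 1 1)))
    (by simpa using hd)
  convert! h using 1
  · funext t
    simp only [mobius, Pi.div_apply, Matrix.mul_apply, Fin.sum_univ_two, Matrix.add_apply,
      Matrix.smul_apply, Matrix.one_apply, smul_eq_mul]
    simp
    congr 1 <;> ring
  · have := congrArg (fun x : ℝ => (x : ℂ)) (det_eq g)
    push_cast at this
    simp only [Complex.ofReal_zero, zero_mul, add_zero, inf]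
    rw [div_mul_eq_mul_div, one_mul]
    congr 1
    linear_combination
      (-(X 0 1 : ℂ) - (X 0 0 - X 1 1) * z + X 1 0 * z ^ 2) * this

theorem fieldS_eq (s : ℝ) (g : Matrix.SpecialLinearGroup (Fin 2) ℝ) :
    fieldS s g = (1 / ((g.1 1 0 : ℂ) * (basePoint s).1 + g.1 1 1) ^ 2 *
          (Complex.I * (Real.exp (s / 2) / 2 : ℝ)),
        1 / ((g.1 1 0 : ℂ) * (basePoint s).2 + g.1 1 1) ^ 2 *
          (Complex.I * (-Real.exp (-s / 2) / 2 : ℝ))) :=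
  (hasDerivAt_curveS s g).deriv

theorem hasDerivAt_curveE (k : Fin 3) (s : ℝ) (hs : 0 < s)
    (g : Matrix.SpecialLinearGroup (Fin 2) ℝ) :
    HasDerivAt (fun t : ℝ => act (g.1 * (1 + t • e k)) (basePoint s))
      (1 / ((g.1 1 0 : ℂ) * (basePoint s).1 + g.1 1 1) ^ 2 * inf (e k) (basePoint s).1,
        1 / ((g.1 1 0 : ℂ) * (basePoint s).2 + g.1 1 1) ^ 2 * inf (e k) (basePoint s).2) 0 :=
  (hasDerivAt_curve (e k) g _ (basePoint_mem s hs).1).prodMk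
    (hasDerivAt_curve (e k) g _ (basePoint_mem s hs).2.1)

theorem fieldE_eq (k : Fin 3) (s : ℝ) (hs : 0 < s) (g : Matrix.SpecialLinearGroup (Fin 2) ℝ) :
    fieldE k s g = (1 / ((g.1 1 0 : ℂ) * (basePoint s).1 + g.1 1 1) ^ 2 * inf (e k) (basePoint s).1,
      1 / ((g.1 1 0 : ℂ) * (basePoint s).2 + g.1 1 1) ^ 2 * inf (e k) (basePoint s).2) :=
  (hasDerivAt_curveE k s hs g).deriv

/-- The distance is invariant. -/
theorem sep_act (M : Matrix (Fin 2) (Fin 2) ℝ) (hM : 0 < M.det) (p : ℂ × ℂ) (h1 : 0 < p.1.im)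
    (h2 : 0 < p.2.im) : sep (act M p) = sep p := by
  have d1 := denom_ne M hM p.1 h1
  have d2 := denom_ne M hM p.2 h2
  have n1 := norm_pos_iff.2 d1
  have n2 := norm_pos_iff.2 d2
  have him : ∀ z : ℂ, (mobius M z).im = M.det * z.im / ‖(M 1 0 : ℂ) * z + M 1 1‖ ^ 2 := by
    intro z
    rw [mobius, Complex.div_im, Matrix.det_fin_two, Complex.sq_norm]
    simp
    ring
  have hsub : mobius M p.1 - mobius M p.2 =
      M.det * (p.1 - p.2) / (((M 1 0 : ℂ) * p.1 + M 1 1) * ((M 1 0 : ℂ) * p.2 + M 1 1)) := by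
    rw [mobius, mobius, Matrix.det_fin_two, div_sub_div _ _ d1 d2]
    push_cast
    ring
  have hs : Real.sqrt ((mobius M p.1).im * (mobius M p.2).im) =
      M.det * Real.sqrt (p.1.im * p.2.im) /
        (‖(M 1 0 : ℂ) * p.1 + M 1 1‖ * ‖(M 1 0 : ℂ) * p.2 + M 1 1‖) := by
    rw [him, him, Real.sqrt_eq_iff_mul_self_eq (by positivity) (by positivity)]
    have := Real.mul_self_sqrt (mul_pos h1 h2).le
    field_simp
    rw [Real.sq_sqrt (mul_pos h1 h2).le]
  have hq : 0 < Real.sqrt (p.1.im * p.2.im) := Real.sqrt_pos.2 (mul_pos h1 h2)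
  simp only [sep, act]
  rw [hsub, hs, norm_div, norm_mul, norm_mul, Complex.norm_real, Real.norm_of_nonneg hM.le]
  congr 2
  have n12 := (mul_pos n1 n2).ne'
  generalize ‖(M 1 0 : ℂ) * p.1 + M 1 1‖ * ‖(M 1 0 : ℂ) * p.2 + M 1 1‖ = N at n12 ⊢
  field_simp

theorem sep_basePoint (s : ℝ) (hs : 0 < s) : sep (basePoint s) = s := by
  have h : (basePoint s).1 - (basePoint s).2 = Complex.I * (2 * Real.sinh (s / 2) : ℝ) := by
    rw [Real.sinh_eq]; simp only [basePoint]; push_cast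
    rw [show -(s : ℂ) / 2 = -(s / 2 : ℂ) by ring]; ring
  have h' : (basePoint s).1.im * (basePoint s).2.im = 1 := by
    simp [basePoint, -Complex.ofReal_exp]; rw [← Real.exp_add]; simp; ring
  have : 0 < Real.sinh (s / 2) := Real.sinh_pos_iff.2 (by positivity)
  rw [sep, h, h', norm_mul, Complex.norm_I, Complex.norm_real, Real.norm_of_nonneg (by positivity)]
  simp
  ring

theorem differentiableAt_sep (p : ℂ × ℂ) (hp : p ∈ space) : DifferentiableAt ℝ sep p := by
  obtain ⟨h1, h2, h3⟩ := hp
  have hq : p.1.im * p.2.im ≠ 0 := (mul_pos h1 h2).ne'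
  have a1 : DifferentiableAt ℝ (fun p : ℂ × ℂ => p.1.im * p.2.im) p :=
    (Complex.imCLM.differentiableAt.comp p differentiableAt_fst).mul
      (Complex.imCLM.differentiableAt.comp p differentiableAt_snd)
  have a2 : DifferentiableAt ℝ (fun p : ℂ × ℂ => ‖p.1 - p.2‖) p :=
    (differentiableAt_fst.sub differentiableAt_snd).norm ℝ (sub_ne_zero.2 h3)
  have hq' : 2 * Real.sqrt (p.1.im * p.2.im) ≠ 0 := by
    have := Real.sqrt_pos.2 (mul_pos h1 h2); positivity
  have a3 : DifferentiableAt ℝ (fun p : ℂ × ℂ => 2 * Real.sqrt (p.1.im * p.2.im)) p :=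
    (a1.sqrt hq).const_mul 2
  have a4 : DifferentiableAt ℝ
      (fun p : ℂ × ℂ => ‖p.1 - p.2‖ / (2 * Real.sqrt (p.1.im * p.2.im))) p := by
    simp only [div_eq_mul_inv]
    exact a2.mul (a3.inv hq')
  exact a4.arsinh.const_mul 2

theorem act_mem (g : Matrix.SpecialLinearGroup (Fin 2) ℝ) (p : ℂ × ℂ) (hp : p ∈ space) :
    act g.1 p ∈ space := by
  obtain ⟨h1, h2, h3⟩ := hp
  have e1 := mobius_coe g ⟨p.1, h1⟩
  have e2 := mobius_coe g ⟨p.2, h2⟩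
  refine ⟨?_, ?_, ?_⟩
  · simp only [act]; erw [e1]; exact (g • (⟨p.1, h1⟩ : UpperHalfPlane)).im_pos
  · simp only [act]; erw [e2]; exact (g • (⟨p.2, h2⟩ : UpperHalfPlane)).im_pos
  · simp only [act]
    erw [e1, e2]
    intro h
    have := MulAction.injective g (UpperHalfPlane.ext h)
    exact h3 (congrArg UpperHalfPlane.coe this)

theorem ds_fieldS (s : ℝ) (hs : 0 < s) (g : Matrix.SpecialLinearGroup (Fin 2) ℝ) :
    ds (act g.1 (basePoint s)) (fieldS s g) = 1 := by
  have h1 := (differentiableAt_sep _ (act_mem g _ (basePoint_mem s hs))).hasFDerivAt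
  have h2 := h1.comp_hasDerivAt s (hasDerivAt_curveS s g)
  rw [ds, fieldS_eq]
  refine h2.unique ?_
  refine (hasDerivAt_id s).congr_of_eventuallyEq ?_
  filter_upwards [lt_mem_nhds hs] with t ht
  obtain ⟨m1, m2, -⟩ := basePoint_mem t ht
  simp only [Function.comp, id]
  rw [sep_act _ (by rw [g.2]; exact one_pos) _ m1 m2, sep_basePoint t ht]

theorem ds_fieldE (k : Fin 3) (s : ℝ) (hs : 0 < s) (g : Matrix.SpecialLinearGroup (Fin 2) ℝ) :
    ds (act g.1 (basePoint s)) (fieldE k s g) = 0 := by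
  have h1 := (differentiableAt_sep _ (act_mem g _ (basePoint_mem s hs))).hasFDerivAt
  have hz : act (g.1 * (1 + (0 : ℝ) • e k)) (basePoint s) = act g.1 (basePoint s) := by simp
  rw [← hz] at h1
  have h2 := h1.comp_hasDerivAt (0 : ℝ) (hasDerivAt_curveE k s hs g)
  rw [ds, fieldE_eq k s hs, ← hz]
  refine h2.unique ?_
  refine (hasDerivAt_const (0 : ℝ) s).congr_of_eventuallyEq ?_
  have hc : Continuous fun t : ℝ => (1 + t • e k).det := by fun_prop
  have := hc.tendsto 0
  simp only [zero_smul, add_zero, Matrix.det_one] at this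
  filter_upwards [this (lt_mem_nhds one_pos)] with t ht
  obtain ⟨m1, m2, -⟩ := basePoint_mem s hs
  have ht' : 0 < (g.1 * (1 + t • e k)).det := by rw [Matrix.det_mul, g.2, one_mul]; exact ht
  simp only [Function.comp]
  rw [sep_act _ ht' _ m1 m2, sep_basePoint s hs]

theorem act_mul (g h : Matrix.SpecialLinearGroup (Fin 2) ℝ) (p : ℂ × ℂ) (hp : p ∈ space) :
    act (g * h).1 p = act g.1 (act h.1 p) := by
  obtain ⟨h1, h2, -⟩ := hp
  have key : ∀ z : UpperHalfPlane, mobius (g * h).1 z = mobius g.1 (mobius h.1 z) := by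
    intro z; rw [mobius_coe, mobius_coe, mobius_coe, mul_smul]
  exact Prod.ext (key ⟨p.1, h1⟩) (key ⟨p.2, h2⟩)

theorem act_one (p : ℂ × ℂ) : act (1 : Matrix.SpecialLinearGroup (Fin 2) ℝ).1 p = p := by
  simp [act, mobius]

theorem exists_act_eq_axis (r : ℝ) (hr : 0 < r) (hr1 : r ≠ 1) :
    ∃ s : ℝ, 0 < s ∧ ∃ g : Matrix.SpecialLinearGroup (Fin 2) ℝ,
      act g.1 (basePoint s) = (Complex.I, Complex.I * r) := by
  have h4 : ∀ x : ℝ, Real.exp (x / 4) * Real.exp (-x / 4) = 1 := fun x => by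
    rw [← Real.exp_add]; simp; ring
  have hx := Real.exp_log hr
  rcases lt_or_gt_of_ne hr1 with h | h
  · refine ⟨-Real.log r, by linarith [Real.log_neg hr h],
      ⟨!![Real.exp (Real.log r / 4), 0; 0, Real.exp (-Real.log r / 4)], ?_⟩, ?_⟩
    · rw [Matrix.det_fin_two_of]; linarith [h4 (Real.log r)]
    · have e1 : (Real.exp (Real.log r / 4) : ℂ) * Real.exp (-Real.log r / 2) =
          Real.exp (-Real.log r / 4) := by
        rw [← Complex.ofReal_mul, ← Real.exp_add]; congr 2; ring
      have e2 : (Real.exp (Real.log r / 4) : ℂ) * Real.exp (- -Real.log r / 2) =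
          r * Real.exp (-Real.log r / 4) := by
        rw [show (r : ℂ) = (Real.exp (Real.log r) : ℝ) by rw [hx]]
        rw [← Complex.ofReal_mul, ← Complex.ofReal_mul, ← Real.exp_add, ← Real.exp_add]
        congr 2; ring
      have n : (Real.exp (-Real.log r / 4) : ℂ) ≠ 0 := by
        exact_mod_cast (Real.exp_pos _).ne'
      simp only [act, mobius, basePoint]
      ext1
      · simp [-Complex.ofReal_exp]
        rw [div_eq_iff n]; linear_combination Complex.I * e1
      · simp [-Complex.ofReal_exp] at e2 ⊢
        rw [div_eq_iff n]; linear_combination Complex.I * e2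
  · refine ⟨Real.log r, Real.log_pos h,
      ⟨!![0, Real.exp (Real.log r / 4); -Real.exp (-Real.log r / 4), 0], ?_⟩, ?_⟩
    · rw [Matrix.det_fin_two_of]; linarith [h4 (Real.log r)]
    · have e1 : (Real.exp (-Real.log r / 4) : ℂ) * Real.exp (Real.log r / 2) =
          Real.exp (Real.log r / 4) := by
        rw [← Complex.ofReal_mul, ← Real.exp_add]; congr 2; ring
      have e2 : (r : ℂ) * (Real.exp (-Real.log r / 4) * Real.exp (-Real.log r / 2)) =
          Real.exp (Real.log r / 4) := by
        rw [show (r : ℂ) = (Real.exp (Real.log r) : ℝ) by rw [hx]]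
        rw [← Complex.ofReal_mul, ← Complex.ofReal_mul, ← Real.exp_add, ← Real.exp_add]
        congr 2; ring
      have n : (Real.exp (-Real.log r / 4) : ℂ) ≠ 0 := by
        exact_mod_cast (Real.exp_pos _).ne'
      have n1 : (Real.exp (Real.log r / 2) : ℂ) ≠ 0 := by
        exact_mod_cast (Real.exp_pos _).ne'
      have n2 : (Real.exp (-Real.log r / 2) : ℂ) ≠ 0 := by
        exact_mod_cast (Real.exp_pos _).ne'
      have hI := Complex.I_mul_I
      simp only [act, mobius, basePoint]
      ext1
      · simp [-Complex.ofReal_exp]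
        rw [div_eq_iff (by
          simp only [ne_eq, neg_eq_zero, mul_eq_zero, not_or]
          exact ⟨n, Complex.I_ne_zero, n1⟩)]
        linear_combination (Real.exp (-Real.log r / 4) * Real.exp (Real.log r / 2) : ℂ) * hI - e1
      · simp [-Complex.ofReal_exp]
        rw [div_eq_iff (by
          simp only [ne_eq, neg_eq_zero, mul_eq_zero, not_or]
          exact ⟨n, Complex.I_ne_zero, n2⟩)]
        linear_combination
          (r * Real.exp (-Real.log r / 4) * Real.exp (-Real.log r / 2) : ℂ) * hI - e2

theorem exists_rotation (w : ℂ) (hw : 0 < w.im) (hwI : w ≠ Complex.I) :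
    ∃ k : Matrix.SpecialLinearGroup (Fin 2) ℝ, ∃ r : ℝ, 0 < r ∧ r ≠ 1 ∧
      act k.1 (Complex.I, w) = (Complex.I, Complex.I * r) := by
  let v : ℂ := ⟨(1 - Complex.normSq w) / 2, -w.re⟩
  have hv : v ≠ 0 := by
    intro h
    have h1 := congrArg Complex.re h
    have h2 := congrArg Complex.im h
    simp [v] at h1 h2
    rw [Complex.normSq_apply, h2] at h1
    apply hwI
    apply Complex.ext
    · simpa using h2
    · simp; nlinarith
  have hn : ‖v‖ ≠ 0 := norm_ne_zero_iff.2 hv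
  have hc := Complex.norm_mul_cos_arg v
  have hs := Complex.norm_mul_sin_arg v
  set φ := Complex.arg v with hφ
  have hk : Real.cos φ * w.re + Real.sin φ * ((1 - Complex.normSq w) / 2) = 0 := by
    apply mul_left_cancel₀ hn
    simp only [v] at hc hs
    linear_combination w.re * hc + (1 - Complex.normSq w) / 2 * hs
  have hφ2 : φ = 2 * (φ / 2) := by ring
  rw [hφ2, Real.cos_two_mul, Real.sin_two_mul] at hk
  have hcs := Real.sin_sq_add_cos_sq (φ / 2)
  let k : Matrix.SpecialLinearGroup (Fin 2) ℝ :=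
    ⟨!![Real.cos (φ / 2), Real.sin (φ / 2); -Real.sin (φ / 2), Real.cos (φ / 2)], by
      rw [Matrix.det_fin_two_of]; linarith⟩
  have hd := denom_ne k.1 (by rw [k.2]; exact one_pos) w hw
  have hdI := denom_ne k.1 (by rw [k.2]; exact one_pos) Complex.I (by simp)
  have hI : mobius k.1 Complex.I = Complex.I := by
    rw [mobius, div_eq_iff hdI]
    simp only [k]
    simp [-Complex.ofReal_cos, -Complex.ofReal_sin]
    linear_combination (Real.sin (φ / 2) : ℂ) * Complex.I_mul_I
  have hre : (mobius k.1 w).re = 0 := by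
    rw [mobius, Complex.div_re, ← add_div]
    apply div_eq_zero_iff.2
    left
    simp only [k]
    simp [-Complex.ofReal_cos, -Complex.ofReal_sin]
    rw [Complex.normSq_apply] at hk
    linear_combination hk - w.re * hcs
  have him : 0 < (mobius k.1 w).im := by
    have := mobius_coe k ⟨w, hw⟩
    erw [this]
    exact (k • (⟨w, hw⟩ : UpperHalfPlane)).im_pos
  have heq : mobius k.1 w = Complex.I * (mobius k.1 w).im := by
    apply Complex.ext <;> simp [hre]
  refine ⟨k, (mobius k.1 w).im, him, ?_, Prod.ext hI heq⟩
  intro h1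
  rw [h1] at heq
  have e1 := mobius_coe k ⟨w, hw⟩
  have e2 := mobius_coe k UpperHalfPlane.I
  have : k • (⟨w, hw⟩ : UpperHalfPlane) = k • UpperHalfPlane.I := by
    apply UpperHalfPlane.ext
    rw [← e1, ← e2]
    simpa [hI] using heq
  have := congrArg UpperHalfPlane.coe (MulAction.injective k this)
  exact hwI (by simpa using this)

/-- Every point of `space` is `g ⊙ w_s` for some `s > 0` and `g`. -/
theorem exists_act_eq (p : ℂ × ℂ) (hp : p ∈ space) :
    ∃ s : ℝ, 0 < s ∧ ∃ g : Matrix.SpecialLinearGroup (Fin 2) ℝ, act g.1 (basePoint s) = p := by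
  have hp' := hp
  obtain ⟨h1, h2, h3⟩ := hp
  let h := (⟨p.1, h1⟩ : UpperHalfPlane).toSL2R
  have hI : h⁻¹ • (⟨p.1, h1⟩ : UpperHalfPlane) = UpperHalfPlane.I := by
    rw [inv_smul_eq_iff, UpperHalfPlane.toSL2R_smul_I]
  have a1 : (act h⁻¹.1 p).1 = Complex.I := by
    have := mobius_coe h⁻¹ ⟨p.1, h1⟩
    rw [hI] at this
    exact this
  have m := act_mem h⁻¹ p hp'
  obtain ⟨k, r, hr, hr1, hk⟩ := exists_rotation (act h⁻¹.1 p).2 m.2.1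
    (fun h => m.2.2 (a1.trans h.symm))
  rw [← a1] at hk
  obtain ⟨s, hs, g, hg⟩ := exists_act_eq_axis r hr hr1
  have hkg : act (k * h⁻¹).1 p = act g.1 (basePoint s) := by
    rw [act_mul k _ _ hp', hg, ← a1]; exact hk
  refine ⟨s, hs, (k * h⁻¹)⁻¹ * g, ?_⟩
  rw [act_mul _ _ _ (basePoint_mem s hs), ← hkg, ← act_mul _ _ _ hp', inv_mul_cancel, act_one]

/-- The stabilizer of `w_s` is trivial in the projective group. -/
theorem eq_one_or_neg_one (s : ℝ) (hs : 0 < s) (k : Matrix.SpecialLinearGroup (Fin 2) ℝ)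
    (h : act k.1 (basePoint s) = basePoint s) : k = 1 ∨ k = -1 := by
  obtain ⟨m1, m2, -⟩ := basePoint_mem s hs
  have d1 := denom_ne k.1 (by rw [k.2]; exact one_pos) _ m1
  have d2 := denom_ne k.1 (by rw [k.2]; exact one_pos) _ m2
  have q1 := congrArg Prod.fst h
  have q2 := congrArg Prod.snd h
  simp only [act, mobius] at q1 q2
  rw [div_eq_iff d1] at q1
  rw [div_eq_iff d2] at q2
  have r1 := congrArg Complex.re q1
  have r1' := congrArg Complex.im q1
  have r2 := congrArg Complex.re q2
  simp [basePoint, -Complex.ofReal_exp] at r1 r1' r2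
  have hd := det_eq k
  have hlt : Real.exp (-s / 2) < Real.exp (s / 2) := Real.exp_lt_exp.2 (by linarith)
  have hp1 := Real.exp_pos (-s / 2)
  have hp2 := Real.exp_pos (s / 2)
  have had : k.1 0 0 = k.1 1 1 := by
    apply mul_right_cancel₀ hp2.ne'; linarith
  have hc : k.1 1 0 = 0 := by
    have : k.1 1 0 * (Real.exp (s / 2) ^ 2 - Real.exp (-s / 2) ^ 2) = 0 := by
      linear_combination r1 - r2
    rcases mul_eq_zero.1 this with h | h
    · exact h
    · nlinarith
  have hb : k.1 0 1 = 0 := by rw [r1, hc]; ring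
  rw [hb, had] at hd
  have : k.1 1 1 = 1 ∨ k.1 1 1 = -1 := by
    apply mul_self_eq_one_iff.1; linarith
  rcases this with h1 | h1
  · left; ext i j; fin_cases i <;> fin_cases j <;> simp [hb, hc, had, h1]
  · right; ext i j; fin_cases i <;> fin_cases j <;> simp [hb, hc, had, h1]

/-- The coordinates `(s, g)` are unique, up to the sign of `g`. -/
theorem act_eq_act (s s' : ℝ) (hs : 0 < s) (hs' : 0 < s')
    (g g' : Matrix.SpecialLinearGroup (Fin 2) ℝ)
    (h : act g.1 (basePoint s) = act g'.1 (basePoint s')) : s = s' ∧ (g' = g ∨ g' = -g) := by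
  have hss : s = s' := by
    have := congrArg sep h
    obtain ⟨m1, m2, -⟩ := basePoint_mem s hs
    obtain ⟨m1', m2', -⟩ := basePoint_mem s' hs'
    rwa [sep_act _ (by rw [g.2]; exact one_pos) _ m1 m2, sep_basePoint s hs,
      sep_act _ (by rw [g'.2]; exact one_pos) _ m1' m2', sep_basePoint s' hs'] at this
  refine ⟨hss, ?_⟩
  subst hss
  have hm := basePoint_mem s hs
  have : act (g⁻¹ * g').1 (basePoint s) = basePoint s := by
    rw [act_mul _ _ _ hm, ← h, ← act_mul _ _ _ hm, inv_mul_cancel, act_one]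
  rcases eq_one_or_neg_one s hs _ this with h1 | h1
  · left; exact (inv_mul_eq_one.1 h1).symm
  · right; rw [inv_mul_eq_iff_eq_mul] at h1; rw [h1]; simp

/-- The real linear form `u ↦ Re (a u₁ + b u₂)`. -/
def reForm (a b : ℂ) : ℂ × ℂ →L[ℝ] ℝ :=
  Complex.reCLM.comp ((a • ContinuousLinearMap.fst ℝ ℂ ℂ) + (b • ContinuousLinearMap.snd ℝ ℂ ℂ))

theorem reForm_apply (a b : ℂ) (u : ℂ × ℂ) : reForm a b u = (a * u.1 + b * u.2).re := rfl

/-- Coefficients of `σ_k` at `w_s`. -/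
def sigmaCoeff (k : Fin 3) (x y : ℝ) : ℂ × ℂ :=
  (![((y / (2 * (x + y)) : ℝ), (x / (2 * (x + y)) : ℝ)),
    ((-y / (2 * (x - y)) : ℝ), (x / (2 * (x - y)) : ℝ)),
    (-Complex.I * (y / 4 : ℝ), -Complex.I * (x / 4 : ℝ))] : Fin 3 → ℂ × ℂ) k

theorem mobius_neg (M : Matrix (Fin 2) (Fin 2) ℝ) (z : ℂ) : mobius (-M) z = mobius M z := by
  simp only [mobius, Matrix.neg_apply, Complex.ofReal_neg]
  rw [← neg_div_neg_eq]
  congr 1 <;> ring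

theorem act_neg (M : Matrix (Fin 2) (Fin 2) ℝ) : act (-M) = act M := by
  funext p; simp only [act, mobius_neg]

theorem fieldS_neg (s : ℝ) (g : Matrix.SpecialLinearGroup (Fin 2) ℝ) :
    fieldS s (-g) = fieldS s g := by
  have : (-g).1 = -g.1 := rfl
  simp only [fieldS, this, act_neg]

theorem fieldE_neg (k : Fin 3) (s : ℝ) (g : Matrix.SpecialLinearGroup (Fin 2) ℝ) :
    fieldE k s (-g) = fieldE k s g := by
  have : (-g).1 = -g.1 := rfl
  simp only [fieldE, this, neg_mul, act_neg]

theorem inf_e (k : Fin 3) (x : ℝ) : inf (e k) (Complex.I * x) =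
    (![((1 + x ^ 2 : ℝ) : ℂ), ((1 - x ^ 2 : ℝ) : ℂ), Complex.I * (2 * x : ℝ)] : Fin 3 → ℂ) k := by
  have h := Complex.I_sq
  fin_cases k
  all_goals simp [inf, e, mul_pow]
  all_goals ring

theorem existsUnique_sigma (k : Fin 3) (p : ℂ × ℂ) (hp : p ∈ space) :
    ∃! α : ℂ × ℂ →L[ℝ] ℝ, IsSigma k p α := by
  obtain ⟨s, hs, g, hg⟩ := exists_act_eq p hp
  obtain ⟨m1, m2, -⟩ := basePoint_mem s hs
  have d1 := denom_ne g.1 (by rw [g.2]; exact one_pos) _ m1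
  have d2 := denom_ne g.1 (by rw [g.2]; exact one_pos) _ m2
  have fS := fieldS_eq s g
  have fE := fun j => fieldE_eq j s hs g
  have hxy : Real.exp (s / 2) * Real.exp (-s / 2) = 1 := by
    rw [← Real.exp_add]; simp; ring
  have hlt : Real.exp (-s / 2) < Real.exp (s / 2) := Real.exp_lt_exp.2 (by linarith)
  have hy0 := Real.exp_pos (-s / 2)
  have w1 : (basePoint s).1 = Complex.I * Real.exp (s / 2) := rfl
  have w2 : (basePoint s).2 = Complex.I * Real.exp (-s / 2) := rfl
  generalize hD1 : (g.1 1 0 : ℂ) * (basePoint s).1 + g.1 1 1 = D1 at *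
  generalize hD2 : (g.1 1 0 : ℂ) * (basePoint s).2 + g.1 1 1 = D2 at *
  rw [w1, w2] at fE
  generalize Real.exp (s / 2) = x at *
  generalize Real.exp (-s / 2) = y at *
  have hx0 : 0 < x := hy0.trans hlt
  have hsub : x - y ≠ 0 := (sub_pos.2 hlt).ne'
  have hadd : x + y ≠ 0 := (add_pos hx0 hy0).ne'
  have cancel : ∀ a b c d : ℂ,
      a * D1 ^ 2 * (1 / D1 ^ 2 * c) + b * D2 ^ 2 * (1 / D2 ^ 2 * d) = a * c + b * d := by
    intro a b c d; field_simp
  have span : ∀ u : ℂ × ℂ, ∃ c0 c1 c2 c3 : ℝ, u = c0 • fieldS s g + c1 • fieldE 0 s g +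
      c2 • fieldE 1 s g + c3 • fieldE 2 s g := by
    intro u
    have h1 : u.1 = 1 / D1 ^ 2 * (D1 ^ 2 * u.1) := by field_simp
    have h2 : u.2 = 1 / D2 ^ 2 * (D2 ^ 2 * u.2) := by field_simp
    generalize D1 ^ 2 * u.1 = v at h1
    generalize D2 ^ 2 * u.2 = w at h2
    refine ⟨y * v.im - x * w.im, (y * v.re + x * w.re) / (2 * (x + y)),
      (x * w.re - y * v.re) / (2 * (x - y)), (y * v.im + x * w.im) / 4, ?_⟩
    rw [fS, fE, fE, fE, inf_e, inf_e, inf_e, inf_e, inf_e, inf_e]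
    refine Prod.ext ?_ ?_
    · have hc : v = ((y * v.im - x * w.im : ℝ) : ℂ) * (Complex.I * (x / 2 : ℝ)) +
          ((y * v.re + x * w.re) / (2 * (x + y)) : ℝ) * ((1 + x ^ 2 : ℝ) : ℂ) +
          ((x * w.re - y * v.re) / (2 * (x - y)) : ℝ) * ((1 - x ^ 2 : ℝ) : ℂ) +
          ((y * v.im + x * w.im) / 4 : ℝ) * (Complex.I * (2 * x : ℝ)) := by
        have r1 : 1 + x ^ 2 = x * (x + y) := by linear_combination -hxy
        have r2 : 1 - x ^ 2 = -x * (x - y) := by linear_combination -hxy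
        rw [r1, r2]
        apply Complex.ext <;>
          simp [-Complex.ofReal_div, -Complex.ofReal_mul, -Complex.ofReal_add,
            -Complex.ofReal_sub, -Complex.ofReal_neg]
        · field_simp
          linear_combination -2 * v.re * hxy
        · linear_combination -v.im * hxy
      rw [h1]
      simp only [Prod.fst_add, Prod.smul_fst, Complex.real_smul, Matrix.cons_val]
      linear_combination (1 / D1 ^ 2) * hc
    · have hc : w = ((y * v.im - x * w.im : ℝ) : ℂ) * (Complex.I * (-y / 2 : ℝ)) +
          ((y * v.re + x * w.re) / (2 * (x + y)) : ℝ) * ((1 + y ^ 2 : ℝ) : ℂ) +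
          ((x * w.re - y * v.re) / (2 * (x - y)) : ℝ) * ((1 - y ^ 2 : ℝ) : ℂ) +
          ((y * v.im + x * w.im) / 4 : ℝ) * (Complex.I * (2 * y : ℝ)) := by
        have r1 : 1 + y ^ 2 = y * (x + y) := by linear_combination -hxy
        have r2 : 1 - y ^ 2 = y * (x - y) := by linear_combination -hxy
        rw [r1, r2]
        apply Complex.ext <;>
          simp [-Complex.ofReal_div, -Complex.ofReal_mul, -Complex.ofReal_add,
            -Complex.ofReal_sub, -Complex.ofReal_neg]
        · field_simp
          linear_combination -2 * w.re * hxy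
        · linear_combination -w.im * hxy
      rw [h2]
      simp only [Prod.snd_add, Prod.smul_snd, Complex.real_smul, Matrix.cons_val]
      linear_combination (1 / D2 ^ 2) * hc
  refine existsUnique_of_exists_of_unique
    ⟨reForm ((sigmaCoeff k x y).1 * D1 ^ 2) ((sigmaCoeff k x y).2 * D2 ^ 2), ?_⟩ ?_
  · intro s' hs' g' hg'
    obtain ⟨rfl, hgg⟩ := act_eq_act s s' hs hs' g g' (hg.trans hg'.symm)
    have hS : fieldS s g' = fieldS s g := by
      rcases hgg with rfl | rfl
      · rfl
      · exact fieldS_neg s g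
    have hE : ∀ j, fieldE j s g' = fieldE j s g := by
      rcases hgg with rfl | rfl
      · exact fun _ => rfl
      · exact fun j => fieldE_neg j s g
    rw [hS, fS]
    refine ⟨?_, fun j => ?_⟩
    · rw [reForm_apply, cancel]
      fin_cases k <;> simp [sigmaCoeff, -Complex.ofReal_div, -Complex.ofReal_mul]
      ring
    · rw [hE, fE, reForm_apply, cancel, inf_e, inf_e]
      fin_cases k <;> fin_cases j <;>
        simp [sigmaCoeff, -Complex.ofReal_div, -Complex.ofReal_mul, -Complex.ofReal_add,
          -Complex.ofReal_sub, -Complex.ofReal_pow, -Complex.ofReal_one]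
      all_goals field_simp
      · linear_combination (x + y) * hxy
      · linear_combination (-x - y) * hxy
      · linear_combination (y - x) * hxy
      · linear_combination (x - y) * hxy
      · linear_combination 4 * hxy
  · intro α β hα hβ
    obtain ⟨a0, a⟩ := hα s hs g hg
    obtain ⟨b0, b⟩ := hβ s hs g hg
    refine ContinuousLinearMap.ext fun u => ?_
    obtain ⟨c0, c1, c2, c3, rfl⟩ := span u
    simp only [map_add, map_smul, a0, b0, a, b]

open Classical in
/-- The 1-form `σ_k` (with index `k = 0, 1, 2` for `σ₁, σ₂, σ₃`), extended by zero outside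
`space`. -/
def sigma (k : Fin 3) (p : ℂ × ℂ) : ℂ × ℂ →L[ℝ] ℝ :=
  if hp : p ∈ space then (existsUnique_sigma k p hp).choose else 0

theorem sigma_fieldS (k : Fin 3) (s : ℝ) (hs : 0 < s)
    (g : Matrix.SpecialLinearGroup (Fin 2) ℝ) :
    sigma k (act g.1 (basePoint s)) (fieldS s g) = 0 := by
  have hp := act_mem g _ (basePoint_mem s hs)
  rw [sigma, dif_pos hp]
  exact ((existsUnique_sigma k _ hp).choose_spec.1 s hs g rfl).1

theorem sigma_fieldE (k j : Fin 3) (s : ℝ) (hs : 0 < s)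
    (g : Matrix.SpecialLinearGroup (Fin 2) ℝ) :
    sigma k (act g.1 (basePoint s)) (fieldE j s g) = if j = k then 1 else 0 := by
  have hp := act_mem g _ (basePoint_mem s hs)
  rw [sigma, dif_pos hp]
  exact ((existsUnique_sigma k _ hp).choose_spec.1 s hs g rfl).2 j

end

end TwoVortex

namespace TwoVortex

open Filter Topology

variable {γ : ℂ × ℂ → (ℂ × ℂ →L[ℝ] ℂ × ℂ →L[ℝ] ℝ)}

/-! Every point is `g ⊙ w_s`, so invariance reduces the metric to its values at the points
`basePoint s`. The two points of `w_s` are exchanged by `z ↦ -1/z`; combined with the swap this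
gives an isometry fixing `w_s`, whose differential is a complex linear involution of the tangent
space. Its eigenlines are spanned by `evenVec s` and `oddVec s`; they are orthogonal
(`apply_evenVec_oddVec`), and on a complex line a Hermitian metric is fixed by one number
(`apply_smul_smul`). Hence two functions remain, a = `evenCoeff γ` and b = `oddCoeff γ`.

At `w_s` the frame `∂/∂s, e₁, e₂, e₃` is `-(i/2) oddVec`, `2 cosh(s/2) evenVec`, `2 sinh(s/2)
oddVec`, `2i evenVec`. So it is orthogonal, with squared lengths b/4, 4 cosh²(s/2) a, 4 sinh²(s/2)
b, 4a (`apply_frame_basePoint`), and `apply_eq` transports this by the group.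

Closedness of the Kähler form, tested on `∂/∂s, e₁, e₃`, links the two functions: b sinh(s/2) = 2
cosh(s/2) a' + a sinh(s/2) (`oddCoeff_mul_sinh`). With A = 4 cosh²(s/2) a this says that A /
cosh(s/2) has derivative 2 sinh(s/2) b, which turns the coefficients in b into the stated ones. -/

theorem isOpen_space : IsOpen space := by
  have h1 : IsOpen {p : ℂ × ℂ | 0 < p.1.im} :=
    isOpen_lt continuous_const (Complex.continuous_im.comp continuous_fst)
  have h2 : IsOpen {p : ℂ × ℂ | 0 < p.2.im} :=
    isOpen_lt continuous_const (Complex.continuous_im.comp continuous_snd)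
  have h3 : IsOpen {p : ℂ × ℂ | p.1 ≠ p.2} := isOpen_ne_fun continuous_fst continuous_snd
  exact h1.inter (h2.inter h3)

/-! ### The group action on tangent vectors -/

/-- The square of the automorphy factor `c z + d`, the reciprocal of the derivative of the fractional
linear transformation. -/
noncomputable def factor (M : Matrix (Fin 2) (Fin 2) ℝ) (z : ℂ) : ℂ := ((M 1 0 : ℂ) * z + M 1 1) ^ 2

theorem factor_ne (g : Matrix.SpecialLinearGroup (Fin 2) ℝ) {z : ℂ} (hz : 0 < z.im) :
    factor g.1 z ≠ 0 :=
  pow_ne_zero 2 (denom_ne g.1 (by rw [g.2]; exact one_pos) z hz)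

theorem fderiv_act (g : Matrix.SpecialLinearGroup (Fin 2) ℝ) (p : ℂ × ℂ) (hp : p ∈ space)
    (u : ℂ × ℂ) :
    fderiv ℝ (act g.1) p u = (1 / factor g.1 p.1 * u.1, 1 / factor g.1 p.2 * u.2) := by
  have h1 := (hasDerivAt_mobius g p.1 hp.1).hasFDerivAt.restrictScalars ℝ
  have h2 := (hasDerivAt_mobius g p.2 hp.2.1).hasFDerivAt.restrictScalars ℝ
  have h := (h1.comp p hasFDerivAt_fst).prodMk (h2.comp p hasFDerivAt_snd)
  have h' : HasFDerivAt (act g.1) _ p := h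
  rw [h'.fderiv]
  simp [factor, mul_comm]

/-- Here `u` and `v` are the vectors at the image point and the factors sit at the fixed point `p`.
This lets the metric be differentiated along an orbit with constant arguments. -/
theorem IsMobiusInvariant.apply_act (hG : IsMobiusInvariant γ)
    (g : Matrix.SpecialLinearGroup (Fin 2) ℝ) {p : ℂ × ℂ} (hp : p ∈ space) (u v : ℂ × ℂ) :
    γ (act g.1 p) u v = γ p (factor g.1 p.1 * u.1, factor g.1 p.2 * u.2)
      (factor g.1 p.1 * v.1, factor g.1 p.2 * v.2) := by
  rw [← hG g p hp, fderiv_act g p hp, fderiv_act g p hp]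
  have n1 := factor_ne g hp.1
  have n2 := factor_ne g hp.2.1
  have cancel : ∀ w : ℂ × ℂ, (1 / factor g.1 p.1 * (factor g.1 p.1 * w.1),
      1 / factor g.1 p.2 * (factor g.1 p.2 * w.2)) = w := fun w => by
    ext1 <;> field_simp
  rw [cancel, cancel]

/-! ### The swap symmetry and its eigenvectors at `w_s` -/

theorem exp_half_mul_exp_neg_half (s : ℝ) : Real.exp (s / 2) * Real.exp (-s / 2) = 1 := by
  rw [← Real.exp_add]; simp; ring

/-- The vector `(e^{s/2}, e^{-s/2})`. -/
noncomputable def evenVec (s : ℝ) : ℂ × ℂ := ((Real.exp (s / 2) : ℝ), (Real.exp (-s / 2) : ℝ))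

/-- The vector `(-e^{s/2}, e^{-s/2})`. -/
noncomputable def oddVec (s : ℝ) : ℂ × ℂ := (-(Real.exp (s / 2) : ℝ), (Real.exp (-s / 2) : ℝ))

/-- The matrix acts by `z ↦ -1/z`, the half turn about `i`, which is the midpoint of the segment
joining the two points. -/
theorem swap_basePoint (s : ℝ) :
    act (!![0, 1; -1, 0] : Matrix (Fin 2) (Fin 2) ℝ) (basePoint s) = (basePoint s).swap := by
  have h := congrArg (fun r : ℝ => (r : ℂ)) (exp_half_mul_exp_neg_half s)
  simp only [Complex.ofReal_mul, Complex.ofReal_one] at h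
  have n1 : (Real.exp (s / 2) : ℂ) ≠ 0 := by exact_mod_cast (Real.exp_pos _).ne'
  have n2 : (Real.exp (-s / 2) : ℂ) ≠ 0 := by exact_mod_cast (Real.exp_pos _).ne'
  have hI := Complex.I_ne_zero
  simp only [act, mobius, basePoint, Prod.swap]
  generalize (Real.exp (s / 2) : ℂ) = x at *
  generalize (Real.exp (-s / 2) : ℂ) = y at *
  ext1
  · simp
    field_simp
    linear_combination -h
  · simp
    field_simp
    linear_combination -h

/-- At `w_s` the swap acts on tangent vectors, up to the group, by this involution. -/
theorem apply_basePoint_swap (hG : IsMobiusInvariant γ) (hP : IsSwapInvariant γ) {s : ℝ}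
    (hs : 0 < s) (u v : ℂ × ℂ) :
    γ (basePoint s) u v = γ (basePoint s)
      (-(Real.exp (s / 2) : ℂ) ^ 2 * u.2, -(Real.exp (-s / 2) : ℂ) ^ 2 * u.1)
      (-(Real.exp (s / 2) : ℂ) ^ 2 * v.2, -(Real.exp (-s / 2) : ℂ) ^ 2 * v.1) := by
  let k : Matrix.SpecialLinearGroup (Fin 2) ℝ := ⟨!![0, 1; -1, 0], by simp⟩
  have hk : act k.1 (basePoint s) = (basePoint s).swap := swap_basePoint s
  rw [← hP _ (basePoint_mem s hs), ← hk, hG.apply_act k (basePoint_mem s hs)]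
  have f1 : factor k.1 (basePoint s).1 = -(Real.exp (s / 2) : ℂ) ^ 2 := by
    simp [factor, k, basePoint, mul_pow]
  have f2 : factor k.1 (basePoint s).2 = -(Real.exp (-s / 2) : ℂ) ^ 2 := by
    simp [factor, k, basePoint, mul_pow]
  rw [f1, f2]
  rfl

/-- The eigenvalue is -1 here and +1 for `oddVec`: even and odd refer to the signs of the
coordinates, not to the eigenvalue. -/
theorem swap_evenVec (s : ℝ) (c : ℂ) :
    (-(Real.exp (s / 2) : ℂ) ^ 2 * (c • evenVec s).2,
      -(Real.exp (-s / 2) : ℂ) ^ 2 * (c • evenVec s).1) = -(c • evenVec s) := by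
  have h := congrArg (fun r : ℝ => (r : ℂ)) (exp_half_mul_exp_neg_half s)
  simp only [Complex.ofReal_mul, Complex.ofReal_one] at h
  ext1
  · simp only [evenVec, Prod.smul_fst, Prod.smul_snd, Prod.fst_neg, smul_eq_mul]
    linear_combination -c * (Real.exp (s / 2) : ℂ) * h
  · simp only [evenVec, Prod.smul_fst, Prod.smul_snd, Prod.snd_neg, smul_eq_mul]
    linear_combination -c * (Real.exp (-s / 2) : ℂ) * h

theorem swap_oddVec (s : ℝ) (c : ℂ) :
    (-(Real.exp (s / 2) : ℂ) ^ 2 * (c • oddVec s).2,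
      -(Real.exp (-s / 2) : ℂ) ^ 2 * (c • oddVec s).1) = c • oddVec s := by
  have h := congrArg (fun r : ℝ => (r : ℂ)) (exp_half_mul_exp_neg_half s)
  simp only [Complex.ofReal_mul, Complex.ofReal_one] at h
  ext1
  · simp only [oddVec, Prod.smul_fst, Prod.smul_snd, smul_eq_mul]
    linear_combination -c * (Real.exp (s / 2) : ℂ) * h
  · simp only [oddVec, Prod.smul_fst, Prod.smul_snd, smul_eq_mul]
    linear_combination c * (Real.exp (-s / 2) : ℂ) * h

/-- An isometric involution makes its two eigenspaces orthogonal: applying it turns the value into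
its negative. -/
theorem apply_evenVec_oddVec (hG : IsMobiusInvariant γ) (hP : IsSwapInvariant γ) {s : ℝ}
    (hs : 0 < s) (c d : ℂ) : γ (basePoint s) (c • evenVec s) (d • oddVec s) = 0 := by
  have h := apply_basePoint_swap hG hP hs (c • evenVec s) (d • oddVec s)
  rw [swap_evenVec, swap_oddVec, map_neg, neg_apply] at h
  linarith

/-! ### Hermitian symmetry and the two coefficient functions -/

theorem IsKahlerMetric.apply_smul_smul (hK : IsKahlerMetric γ) {p : ℂ × ℂ} (hp : p ∈ space)
    (c d : ℂ) (u : ℂ × ℂ) :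
    γ p (c • u) (d • u) = (c * starRingEnd ℂ d).re * γ p u u := by
  have hs : ∀ c : ℂ, c • u = c.re • u + c.im • (Complex.I • u) := fun c => by
    conv_lhs => rw [← Complex.re_add_im c, add_smul, mul_smul]
    simp
  have h1 := hK.hermitian p hp u u
  have h2 := hK.hermitian p hp u (Complex.I • u)
  -- Now `h2` equates γ(u, iu) with its negative, so `u` and `iu` are orthogonal; by `h1` they have
  -- equal length.
  rw [smul_smul, Complex.I_mul_I, neg_one_smul, map_neg, hK.symm p hp (Complex.I • u) u] at h2
  have h3 := hK.symm p hp (Complex.I • u) u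
  rw [hs c, hs d]
  simp only [map_add, map_smul, add_apply, smul_apply,
    smul_eq_mul, h1, h3, Complex.mul_re, Complex.conj_re, Complex.conj_im]
  linear_combination (c.re * d.im + c.im * d.re) * (-1 / 2) * h2

/-- The value of an invariant Kähler metric on the even vector at `w_s`. -/
noncomputable def evenCoeff (γ : ℂ × ℂ → (ℂ × ℂ →L[ℝ] ℂ × ℂ →L[ℝ] ℝ)) (s : ℝ) : ℝ :=
  γ (basePoint s) (evenVec s) (evenVec s)

/-- The value of an invariant Kähler metric on the odd vector at `w_s`. -/
noncomputable def oddCoeff (γ : ℂ × ℂ → (ℂ × ℂ →L[ℝ] ℂ × ℂ →L[ℝ] ℝ)) (s : ℝ) : ℝ :=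
  γ (basePoint s) (oddVec s) (oddVec s)

theorem eq_evenVec_add_oddVec (s : ℝ) (u : ℂ × ℂ) :
    u = (((Real.exp (-s / 2) : ℝ) * u.1 + (Real.exp (s / 2) : ℝ) * u.2) / 2) • evenVec s +
      (((Real.exp (s / 2) : ℝ) * u.2 - (Real.exp (-s / 2) : ℝ) * u.1) / 2) • oddVec s := by
  have h := congrArg (fun r : ℝ => (r : ℂ)) (exp_half_mul_exp_neg_half s)
  simp only [Complex.ofReal_mul, Complex.ofReal_one] at h
  ext1
  · simp only [oddVec, evenVec, Prod.smul_fst, Prod.fst_add, smul_eq_mul]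
    linear_combination -u.1 * h
  · simp only [oddVec, evenVec, Prod.smul_snd, Prod.snd_add, smul_eq_mul]
    linear_combination -u.2 * h

/-- The metric at `w_s`. -/
theorem apply_basePoint (hK : IsKahlerMetric γ) (hG : IsMobiusInvariant γ)
    (hP : IsSwapInvariant γ) {s : ℝ} (hs : 0 < s) (u v : ℂ × ℂ) :
    γ (basePoint s) u v =
      evenCoeff γ s / 4 *
        (((Real.exp (-s / 2) : ℝ) * u.1 + (Real.exp (s / 2) : ℝ) * u.2) *
          starRingEnd ℂ ((Real.exp (-s / 2) : ℝ) * v.1 + (Real.exp (s / 2) : ℝ) * v.2)).re +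
      oddCoeff γ s / 4 *
        (((Real.exp (s / 2) : ℝ) * u.2 - (Real.exp (-s / 2) : ℝ) * u.1) *
          starRingEnd ℂ ((Real.exp (s / 2) : ℝ) * v.2 - (Real.exp (-s / 2) : ℝ) * v.1)).re := by
  have hm := basePoint_mem s hs
  have key : ∀ c d : ℂ, (c / 2 * starRingEnd ℂ (d / 2)).re = (c * starRingEnd ℂ d).re / 4 := by
    intro c d
    have h2 : starRingEnd ℂ 2 = 2 := Complex.conj_ofNat 2
    rw [map_div₀, h2, div_mul_div_comm]
    norm_num [Complex.div_re]
  conv_lhs => rw [eq_evenVec_add_oddVec s u, eq_evenVec_add_oddVec s v]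
  rw [map_add, map_add, add_apply, add_apply,
    apply_evenVec_oddVec hG hP hs, hK.symm _ hm (_ • oddVec s) (_ • evenVec s),
    apply_evenVec_oddVec hG hP hs, hK.apply_smul_smul hm, hK.apply_smul_smul hm, key, key,
    evenCoeff, oddCoeff]
  ring

/-! ### Smoothness of the coefficient functions -/

theorem contDiff_ofReal_exp_half : ContDiff ℝ ∞ fun s : ℝ => ((Real.exp (s / 2) : ℝ) : ℂ) :=
  Complex.ofRealCLM.contDiff.comp (Real.contDiff_exp.comp (by fun_prop))

theorem contDiff_ofReal_exp_neg_half :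
    ContDiff ℝ ∞ fun s : ℝ => ((Real.exp (-s / 2) : ℝ) : ℂ) :=
  Complex.ofRealCLM.contDiff.comp (Real.contDiff_exp.comp (by fun_prop))

theorem IsKahlerMetric.contDiffOn_apply_basePoint (hK : IsKahlerMetric γ) {f : ℝ → ℂ × ℂ}
    (hf : ContDiff ℝ ∞ f) : ContDiffOn ℝ ∞ (fun s => γ (basePoint s) (f s) (f s)) (Ioi 0) := by
  have h2 : ContDiff ℝ ∞ basePoint := (contDiff_const.mul contDiff_ofReal_exp_half).prodMk
    (contDiff_const.mul contDiff_ofReal_exp_neg_half)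
  have h3 : ContDiffOn ℝ ∞ (fun s => γ (basePoint s)) (Ioi 0) :=
    hK.smooth.comp h2.contDiffOn fun s hs => basePoint_mem s hs
  exact (h3.clm_apply hf.contDiffOn).clm_apply hf.contDiffOn

theorem contDiffOn_evenCoeff (hK : IsKahlerMetric γ) : ContDiffOn ℝ ∞ (evenCoeff γ) (Ioi 0) :=
  hK.contDiffOn_apply_basePoint (contDiff_ofReal_exp_half.prodMk contDiff_ofReal_exp_neg_half)

theorem contDiffOn_oddCoeff (hK : IsKahlerMetric γ) : ContDiffOn ℝ ∞ (oddCoeff γ) (Ioi 0) :=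
  hK.contDiffOn_apply_basePoint
    (contDiff_ofReal_exp_half.neg.prodMk contDiff_ofReal_exp_neg_half)

theorem differentiableAt_evenCoeff (hK : IsKahlerMetric γ) {s : ℝ} (hs : 0 < s) :
    DifferentiableAt ℝ (evenCoeff γ) s :=
  ((contDiffOn_evenCoeff hK).contDiffAt (Ioi_mem_nhds hs)).differentiableAt (by simp)

theorem differentiableAt_oddCoeff (hK : IsKahlerMetric γ) {s : ℝ} (hs : 0 < s) :
    DifferentiableAt ℝ (oddCoeff γ) s :=
  ((contDiffOn_oddCoeff hK).contDiffAt (Ioi_mem_nhds hs)).differentiableAt (by simp)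

/-! ### Closedness and derivatives along orbits -/

theorem IsKahlerMetric.differentiableAt_apply (hK : IsKahlerMetric γ) {p : ℂ × ℂ}
    (hp : p ∈ space) (u v : ℂ × ℂ) : DifferentiableAt ℝ (fun q => γ q u v) p := by
  have h := (hK.smooth.contDiffAt (isOpen_space.mem_nhds hp)).differentiableAt (by simp)
  exact (h.clm_apply (differentiableAt_const u)).clm_apply (differentiableAt_const v)

/-- Closedness of the Kähler form, in terms of the metric. -/
theorem IsKahlerMetric.fderiv_cyclic (hK : IsKahlerMetric γ) {p : ℂ × ℂ} (hp : p ∈ space)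
    (v₀ v₁ v₂ : ℂ × ℂ) :
    fderiv ℝ (fun q => γ q (Complex.I • v₁) v₂) p v₀ -
      fderiv ℝ (fun q => γ q (Complex.I • v₀) v₂) p v₁ +
      fderiv ℝ (fun q => γ q (Complex.I • v₀) v₁) p v₂ = 0 := by
  obtain ⟨Ω, hΩ, hs, hd⟩ := hK.closed
  have hdiff : DifferentiableAt ℝ Ω p :=
    (hs.contDiffAt (isOpen_space.mem_nhds hp)).differentiableAt (by simp)
  -- For constant vectors the exterior derivative is an alternating sum of directional derivatives,
  -- without bracket terms.
  have h := extDeriv_apply hdiff ![v₀, v₁, v₂]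
  rw [hd p hp] at h
  -- `Ω` is tied to the metric only on `space`; since `space` is open, they agree near `p`, which
  -- suffices for derivatives.
  have hf : ∀ (w : Fin 2 → ℂ × ℂ) (u v : ℂ × ℂ), w = ![u, v] →
      fderiv ℝ (fun q => Ω q w) p = fderiv ℝ (fun q => γ q (Complex.I • u) v) p := by
    rintro _ u v rfl
    apply Filter.EventuallyEq.fderiv_eq
    filter_upwards [isOpen_space.mem_nhds hp] with q hq using hΩ q hq u v
  rw [Fin.sum_univ_three, hf _ v₁ v₂ (by ext i <;> fin_cases i <;> rfl),
    hf _ v₀ v₂ (by ext i <;> fin_cases i <;> rfl),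
    hf _ v₀ v₁ (by ext i <;> fin_cases i <;> rfl)] at h
  simp at h
  linarith

/-- The derivative of an invariant metric along a one-parameter family of transformations. -/
theorem IsMobiusInvariant.fderiv_apply (hK : IsKahlerMetric γ) (hG : IsMobiusInvariant γ)
    {p : ℂ × ℂ} (hp : p ∈ space) {g : ℝ → Matrix.SpecialLinearGroup (Fin 2) ℝ} (hg : g 0 = 1)
    {w : ℂ × ℂ} (hw : HasDerivAt (fun t => act (g t).1 p) w 0) {m : ℂ × ℂ}
    (hm : HasDerivAt (fun t => (factor (g t).1 p.1, factor (g t).1 p.2)) m 0) (u v : ℂ × ℂ) :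
    fderiv ℝ (fun q => γ q u v) p w = γ p (m * u) v + γ p u (m * v) := by
  have h0 : act (g 0).1 p = p := by rw [hg, act_one]
  -- The function `t ↦ γ (g_t p) u v` is differentiated twice: by the chain rule (`h1`), and after
  -- moving the motion into the arguments by invariance (`h2`).
  have hd := (hK.differentiableAt_apply hp u v).hasFDerivAt
  rw [← h0] at hd
  have h1 := hd.comp_hasDerivAt (0 : ℝ) hw
  rw [h0] at h1
  have hu := hm.mul_const u
  have hv := hm.mul_const v
  have hone : (factor (g 0).1 p.1, factor (g 0).1 p.2) = 1 := by
    rw [hg]; ext1 <;> simp [factor]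
  have h2 : HasDerivAt (fun t => γ p ((factor (g t).1 p.1, factor (g t).1 p.2) * u)
      ((factor (g t).1 p.1, factor (g t).1 p.2) * v)) _ 0 :=
    (((γ p).hasFDerivAt.comp_hasDerivAt (0 : ℝ) hu).clm_apply hv)
  simp only [Function.comp_def, hone, one_mul] at h2
  refine h1.unique (h2.congr_of_eventuallyEq (Eventually.of_forall fun t => ?_))
  exact hG.apply_act (g t) hp u v

/-! ### Two one-parameter subgroups and their velocities -/

/-- The hyperbolic one-parameter group generated by `e 0`. -/
noncomputable def boost (t : ℝ) : Matrix.SpecialLinearGroup (Fin 2) ℝ :=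
  ⟨!![Real.cosh t, Real.sinh t; Real.sinh t, Real.cosh t], by
    rw [Matrix.det_fin_two_of]; linarith [Real.cosh_sq t]⟩

/-- The hyperbolic one-parameter group generated by `e 2`. -/
noncomputable def dilation (t : ℝ) : Matrix.SpecialLinearGroup (Fin 2) ℝ :=
  ⟨!![Real.exp t, 0; 0, Real.exp (-t)], by
    rw [Matrix.det_fin_two_of, ← Real.exp_add]; simp⟩

theorem boost_zero : boost 0 = 1 := by
  ext i j
  fin_cases i <;> fin_cases j <;> simp [boost]

theorem dilation_zero : dilation 0 = 1 := by
  ext i j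
  fin_cases i <;> fin_cases j <;> simp [dilation]

theorem hasDerivAt_mobius_boost (z : ℂ) :
    HasDerivAt (fun t => mobius (boost t).1 z) (1 - z ^ 2) 0 := by
  have hc : HasDerivAt (fun t : ℝ => (Real.cosh t : ℂ)) ((0 : ℝ) : ℂ) 0 := by
    simpa using (Real.hasDerivAt_cosh 0).ofReal_comp
  have hs : HasDerivAt (fun t : ℝ => (Real.sinh t : ℂ)) ((1 : ℝ) : ℂ) 0 := by
    simpa using (Real.hasDerivAt_sinh 0).ofReal_comp
  have h := ((hc.mul_const z).add hs).div ((hs.mul_const z).add hc) (by simp)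
  convert! h using 1
  simp
  ring

theorem hasDerivAt_factor_boost (z : ℂ) :
    HasDerivAt (fun t => factor (boost t).1 z) (2 * z) 0 := by
  have hc : HasDerivAt (fun t : ℝ => (Real.cosh t : ℂ)) ((0 : ℝ) : ℂ) 0 := by
    simpa using (Real.hasDerivAt_cosh 0).ofReal_comp
  have hs : HasDerivAt (fun t : ℝ => (Real.sinh t : ℂ)) ((1 : ℝ) : ℂ) 0 := by
    simpa using (Real.hasDerivAt_sinh 0).ofReal_comp
  have h := ((hs.mul_const z).add hc).pow 2
  convert! h using 1
  simp

theorem hasDerivAt_mobius_dilation (z : ℂ) :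
    HasDerivAt (fun t => mobius (dilation t).1 z) (2 * z) 0 := by
  have hc : HasDerivAt (fun t : ℝ => (Real.exp t : ℂ)) ((1 : ℝ) : ℂ) 0 := by
    simpa using (Real.hasDerivAt_exp 0).ofReal_comp
  have hs : HasDerivAt (fun t : ℝ => (Real.exp (-t) : ℂ)) ((-1 : ℝ) : ℂ) 0 := by
    simpa using ((hasDerivAt_id (0 : ℝ)).neg.exp).ofReal_comp
  have h := (hc.mul_const z).div hs (by simp)
  convert! h using 1
  · funext t
    simp [mobius, dilation]
  · simp
    ring

theorem hasDerivAt_factor_dilation (z : ℂ) :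
    HasDerivAt (fun t => factor (dilation t).1 z) (-2) 0 := by
  have hs : HasDerivAt (fun t : ℝ => (Real.exp (-t) : ℂ)) ((-1 : ℝ) : ℂ) 0 := by
    simpa using ((hasDerivAt_id (0 : ℝ)).neg.exp).ofReal_comp
  have h := hs.pow 2
  convert! h using 1
  · funext t
    simp [factor, dilation]
  · simp

/-! ### The differential equation -/

theorem hasDerivAt_basePoint (s : ℝ) :
    HasDerivAt basePoint (Complex.I * (Real.exp (s / 2) / 2 : ℝ),
      Complex.I * (-Real.exp (-s / 2) / 2 : ℝ)) s := by
  have h := hasDerivAt_curveS s 1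
  simp only [act_one] at h
  simpa using h

/-- The two arguments are complex multiples of `evenVec s` and stay frozen while the base point
moves to `w_t`. Their component along `oddVec t` vanishes at `t = s`, so `oddCoeff` enters only
through a square with zero derivative; the component along `evenVec t` is stationary there, leaving
only the derivative of `evenCoeff`. -/
theorem fderiv_apply_basePoint_transverse (hK : IsKahlerMetric γ) (hG : IsMobiusInvariant γ)
    (hP : IsSwapInvariant γ) {s : ℝ} (hs : 0 < s) :
    fderiv ℝ (fun q => γ q (Complex.I • (1 - (basePoint s).1 ^ 2, 1 - (basePoint s).2 ^ 2))
        (2 * (basePoint s).1, 2 * (basePoint s).2)) (basePoint s)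
      (Complex.I * (Real.exp (s / 2) / 2 : ℝ), Complex.I * (-Real.exp (-s / 2) / 2 : ℝ)) =
    2 * (Real.exp (s / 2) + Real.exp (-s / 2)) * deriv (evenCoeff γ) s := by
  have h1 := (hK.differentiableAt_apply (basePoint_mem s hs)
    (Complex.I • (1 - (basePoint s).1 ^ 2, 1 - (basePoint s).2 ^ 2))
    (2 * (basePoint s).1, 2 * (basePoint s).2)).hasFDerivAt.comp_hasDerivAt s
    (hasDerivAt_basePoint s)
  refine h1.unique ?_
  have ha := (differentiableAt_evenCoeff hK hs).hasDerivAt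
  have hb := (differentiableAt_oddCoeff hK hs).hasDerivAt
  have e1 : HasDerivAt (fun t : ℝ => Real.exp (t / 2)) (Real.exp (s / 2) * (1 / 2)) s :=
    ((hasDerivAt_id s).div_const 2).exp
  have e2 : HasDerivAt (fun t : ℝ => Real.exp (-t / 2)) (Real.exp (-s / 2) * (-1 / 2)) s :=
    ((hasDerivAt_id s).neg.div_const 2).exp
  have hxy := exp_half_mul_exp_neg_half s
  -- Half of each unsquared sum is a coordinate of `evenVec s` in the basis `evenVec t`, `oddVec t`.
  -- At `t = s` the first sum is 2 with derivative 0, and the second is 0.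
  have hF := ((e2.mul_const (Real.exp (s / 2))).add (e1.mul_const (Real.exp (-s / 2)))).pow 2
  have hD := ((e1.mul_const (Real.exp (-s / 2))).sub (e2.mul_const (Real.exp (s / 2)))).pow 2
  have h := ((ha.mul hF).add (hb.mul hD)).const_mul
    ((Real.exp (s / 2) + Real.exp (-s / 2)) / 2)
  refine (h.congr_of_eventuallyEq ?_).congr_deriv ?_
  · filter_upwards [lt_mem_nhds hs] with t ht
    simp only [Function.comp, apply_basePoint hK hG hP ht]
    simp only [basePoint]
    simp only [Pi.add_apply, Pi.mul_apply, Pi.sub_apply, Pi.pow_apply]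
    generalize Real.exp (s / 2) = x at *
    generalize Real.exp (-s / 2) = y at *
    generalize Real.exp (t / 2) = X at *
    generalize Real.exp (-t / 2) = Y at *
    -- Writing 1 as `x * y` exhibits the vector as `(x + y)` times `evenVec s`.
    have r1 : 1 - (Complex.I * x) ^ 2 = ((x * (x + y) : ℝ) : ℂ) := by
      rw [mul_pow, Complex.I_sq, mul_add, hxy]; push_cast; ring
    have r2 : 1 - (Complex.I * y) ^ 2 = ((y * (x + y) : ℝ) : ℂ) := by
      rw [mul_pow, Complex.I_sq, mul_add, mul_comm y x, hxy]; push_cast; ring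
    rw [r1, r2]
    simp [-Complex.ofReal_mul, -Complex.ofReal_add]
    ring
  · simp only [Pi.add_apply, Pi.sub_apply, Pi.pow_apply]
    generalize Real.exp (s / 2) = x at *
    generalize Real.exp (-s / 2) = y at *
    linear_combination (2 * (x + y) * deriv (evenCoeff γ) s * (x * y + 1)) * hxy

/-- The only differential equation imposed by the closedness of the Kähler form. -/
theorem oddCoeff_mul_sinh (hK : IsKahlerMetric γ) (hG : IsMobiusInvariant γ)
    (hP : IsSwapInvariant γ) {s : ℝ} (hs : 0 < s) :
    oddCoeff γ s * Real.sinh (s / 2) =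
      2 * Real.cosh (s / 2) * deriv (evenCoeff γ) s + Real.sinh (s / 2) * evenCoeff γ s := by
  have hm := basePoint_mem s hs
  have h := hK.fderiv_cyclic hm
    (Complex.I * (Real.exp (s / 2) / 2 : ℝ), Complex.I * (-Real.exp (-s / 2) / 2 : ℝ))
    (1 - (basePoint s).1 ^ 2, 1 - (basePoint s).2 ^ 2) (2 * (basePoint s).1, 2 * (basePoint s).2)
  -- The boost factor has derivative `2z`, which mixes even and odd vectors; its term is `2
  -- sinh(s/2)` times `oddCoeff γ s - evenCoeff γ s`. The dilation factor has the scalar derivative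
  -- -2, so its term pairs an odd with an even vector and vanishes.
  rw [fderiv_apply_basePoint_transverse hK hG hP hs,
    IsMobiusInvariant.fderiv_apply hK hG hm boost_zero
      ((hasDerivAt_mobius_boost _).prodMk (hasDerivAt_mobius_boost _))
      ((hasDerivAt_factor_boost _).prodMk (hasDerivAt_factor_boost _)),
    IsMobiusInvariant.fderiv_apply hK hG hm dilation_zero
      ((hasDerivAt_mobius_dilation _).prodMk (hasDerivAt_mobius_dilation _))
      ((hasDerivAt_factor_dilation _).prodMk (hasDerivAt_factor_dilation _))] at h
  simp only [apply_basePoint hK hG hP hs] at h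
  have hsh : Real.sinh (s / 2) = (Real.exp (s / 2) - Real.exp (-s / 2)) / 2 := by
    rw [Real.sinh_eq, neg_div]
  have hch : Real.cosh (s / 2) = (Real.exp (s / 2) + Real.exp (-s / 2)) / 2 := by
    rw [Real.cosh_eq, neg_div]
  rw [hsh, hch]
  simp only [basePoint] at h
  have hxy := exp_half_mul_exp_neg_half s
  generalize Real.exp (s / 2) = x at *
  generalize Real.exp (-s / 2) = y at *
  have r1 : 1 - (Complex.I * x) ^ 2 = ((x * (x + y) : ℝ) : ℂ) := by
    rw [mul_pow, Complex.I_sq, mul_add, hxy]; push_cast; ring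
  have r2 : 1 - (Complex.I * y) ^ 2 = ((y * (x + y) : ℝ) : ℂ) := by
    rw [mul_pow, Complex.I_sq, mul_add, mul_comm y x, hxy]; push_cast; ring
  rw [r1, r2] at h
  simp [-Complex.ofReal_mul, -Complex.ofReal_add, -Complex.ofReal_div] at h
  linear_combination (-1 / 2) * h - (x - y) * (oddCoeff γ s - evenCoeff γ s) / 2 * (x * y + 1) * hxy

/-! ### The metric in the invariant frame and coframe -/

theorem exists_frame_basePoint {s : ℝ} (hs : 0 < s) (u : ℂ × ℂ) :
    ∃ c : Fin 4 → ℝ, u = c 0 • fieldS s 1 + c 1 • fieldE 0 s 1 + c 2 • fieldE 1 s 1 +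
      c 3 • fieldE 2 s 1 := by
  have fS := fieldS_eq s 1
  have fE := fun j => fieldE_eq j s hs 1
  have w1 : (basePoint s).1 = Complex.I * Real.exp (s / 2) := rfl
  have w2 : (basePoint s).2 = Complex.I * Real.exp (-s / 2) := rfl
  have hxy := exp_half_mul_exp_neg_half s
  have hlt : Real.exp (-s / 2) < Real.exp (s / 2) := Real.exp_lt_exp.2 (by linarith)
  have hy0 := Real.exp_pos (-s / 2)
  rw [w1, w2] at fE
  simp only [inf_e] at fE
  rw [fS, fE, fE, fE]
  generalize Real.exp (s / 2) = x at *
  generalize Real.exp (-s / 2) = y at *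
  have hx0 : 0 < x := hy0.trans hlt
  have hsub : x - y ≠ 0 := (sub_pos.2 hlt).ne'
  have hadd : x + y ≠ 0 := (add_pos hx0 hy0).ne'
  have r1 : 1 + x ^ 2 = x * (x + y) := by linear_combination -hxy
  have r2 : 1 - x ^ 2 = -x * (x - y) := by linear_combination -hxy
  have r3 : 1 + y ^ 2 = y * (x + y) := by linear_combination -hxy
  have r4 : 1 - y ^ 2 = y * (x - y) := by linear_combination -hxy
  -- The even coordinate of `u` is `(x + y) c₁ + 2i c₃` and the odd one is `(x - y) c₂ - (i/2) c₀`;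
  -- real and imaginary parts give the four coefficients. Here `x ≠ y` because `s > 0`.
  refine ⟨![y * u.1.im - x * u.2.im, (y * u.1.re + x * u.2.re) / (2 * (x + y)),
      (x * u.2.re - y * u.1.re) / (2 * (x - y)), (y * u.1.im + x * u.2.im) / 4], ?_⟩
  rw [r1, r2, r3, r4]
  refine Prod.ext (Complex.ext ?_ ?_) (Complex.ext ?_ ?_) <;>
    simp [-Complex.ofReal_div, -Complex.ofReal_mul, -Complex.ofReal_add,
      -Complex.ofReal_sub, -Complex.ofReal_neg]
  · field_simp
    linear_combination -2 * u.1.re * hxy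
  · linear_combination -u.1.im * hxy
  · field_simp
    linear_combination -2 * u.2.re * hxy
  · linear_combination -u.2.im * hxy

theorem fieldS_one (s : ℝ) : fieldS s 1 = (Complex.I * (Real.exp (s / 2) / 2 : ℝ),
    Complex.I * (-Real.exp (-s / 2) / 2 : ℝ)) := by
  rw [fieldS_eq]; simp

theorem fieldE_one (k : Fin 3) {s : ℝ} (hs : 0 < s) :
    fieldE k s 1 = (inf (e k) (basePoint s).1, inf (e k) (basePoint s).2) := by
  rw [fieldE_eq k s hs]; simp

theorem fderiv_act_fieldS {s : ℝ} (hs : 0 < s) (g : Matrix.SpecialLinearGroup (Fin 2) ℝ) :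
    fderiv ℝ (act g.1) (basePoint s) (fieldS s 1) = fieldS s g := by
  rw [fderiv_act g _ (basePoint_mem s hs), fieldS_one, fieldS_eq s g]
  rfl

theorem fderiv_act_fieldE (k : Fin 3) {s : ℝ} (hs : 0 < s)
    (g : Matrix.SpecialLinearGroup (Fin 2) ℝ) :
    fderiv ℝ (act g.1) (basePoint s) (fieldE k s 1) = fieldE k s g := by
  rw [fderiv_act g _ (basePoint_mem s hs), fieldE_one k hs, fieldE_eq k s hs g]
  rfl

theorem exists_fderiv_act_eq (g : Matrix.SpecialLinearGroup (Fin 2) ℝ) {p : ℂ × ℂ}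
    (hp : p ∈ space) (u : ℂ × ℂ) : ∃ w, fderiv ℝ (act g.1) p w = u := by
  have n1 := factor_ne g hp.1
  have n2 := factor_ne g hp.2.1
  refine ⟨(factor g.1 p.1 * u.1, factor g.1 p.2 * u.2), ?_⟩
  rw [fderiv_act g p hp]
  ext1 <;> field_simp

/-- The metric at `w_s` in the invariant frame. -/
theorem apply_frame_basePoint (hK : IsKahlerMetric γ) (hG : IsMobiusInvariant γ)
    (hP : IsSwapInvariant γ) {s : ℝ} (hs : 0 < s) (c d : Fin 4 → ℝ) :
    γ (basePoint s)
      (c 0 • fieldS s 1 + c 1 • fieldE 0 s 1 + c 2 • fieldE 1 s 1 + c 3 • fieldE 2 s 1)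
      (d 0 • fieldS s 1 + d 1 • fieldE 0 s 1 + d 2 • fieldE 1 s 1 + d 3 • fieldE 2 s 1) =
    oddCoeff γ s / 4 * (c 0 * d 0) + 4 * Real.cosh (s / 2) ^ 2 * evenCoeff γ s * (c 1 * d 1) +
      4 * Real.sinh (s / 2) ^ 2 * oddCoeff γ s * (c 2 * d 2) +
      4 * evenCoeff γ s * (c 3 * d 3) := by
  have w1 : (basePoint s).1 = Complex.I * Real.exp (s / 2) := rfl
  have w2 : (basePoint s).2 = Complex.I * Real.exp (-s / 2) := rfl
  have hsh : Real.sinh (s / 2) = (Real.exp (s / 2) - Real.exp (-s / 2)) / 2 := by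
    rw [Real.sinh_eq, neg_div]
  have hch : Real.cosh (s / 2) = (Real.exp (s / 2) + Real.exp (-s / 2)) / 2 := by
    rw [Real.cosh_eq, neg_div]
  have hxy := exp_half_mul_exp_neg_half s
  rw [apply_basePoint hK hG hP hs, fieldS_one, fieldE_one _ hs, fieldE_one _ hs, fieldE_one _ hs,
    w1, w2, hsh, hch]
  simp only [inf_e]
  generalize Real.exp (s / 2) = x at *
  generalize Real.exp (-s / 2) = y at *
  have r1 : 1 + x ^ 2 = x * (x + y) := by linear_combination -hxy
  have r2 : 1 - x ^ 2 = -x * (x - y) := by linear_combination -hxy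
  have r3 : 1 + y ^ 2 = y * (x + y) := by linear_combination -hxy
  have r4 : 1 - y ^ 2 = y * (x - y) := by linear_combination -hxy
  rw [r1, r2, r3, r4]
  simp [-Complex.ofReal_div, -Complex.ofReal_mul, -Complex.ofReal_add,
      -Complex.ofReal_sub, -Complex.ofReal_neg]
  linear_combination (oddCoeff γ s / 4 * (c 0 * d 0) +
    (x + y) ^ 2 * evenCoeff γ s * (c 1 * d 1) + (x - y) ^ 2 * oddCoeff γ s * (c 2 * d 2) +
    4 * evenCoeff γ s * (c 3 * d 3)) * (x * y + 1) * hxy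

/-- The metric in the invariant coframe. -/
theorem apply_eq (hK : IsKahlerMetric γ) (hG : IsMobiusInvariant γ)
    (hP : IsSwapInvariant γ) {p : ℂ × ℂ} (hp : p ∈ space) (u v : ℂ × ℂ) :
    γ p u v = oddCoeff γ (sep p) / 4 * (ds p u * ds p v) +
      4 * Real.cosh (sep p / 2) ^ 2 * evenCoeff γ (sep p) * (sigma 0 p u * sigma 0 p v) +
      4 * Real.sinh (sep p / 2) ^ 2 * oddCoeff γ (sep p) * (sigma 1 p u * sigma 1 p v) +
      4 * evenCoeff γ (sep p) * (sigma 2 p u * sigma 2 p v) := by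
  obtain ⟨s, hs, g, rfl⟩ := exists_act_eq p hp
  have hm := basePoint_mem s hs
  -- Tangent vectors at `g ⊙ w_s` are images of frame combinations at `w_s`. The left side pulls
  -- back by invariance; on the right the dual coframe reads off the same coefficients.
  obtain ⟨u, rfl⟩ := exists_fderiv_act_eq g hm u
  obtain ⟨v, rfl⟩ := exists_fderiv_act_eq g hm v
  obtain ⟨c, rfl⟩ := exists_frame_basePoint hs u
  obtain ⟨d, rfl⟩ := exists_frame_basePoint hs v
  rw [hG g _ hm, apply_frame_basePoint hK hG hP hs,
    sep_act _ (by rw [g.2]; exact one_pos) _ hm.1 hm.2.1, sep_basePoint s hs]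
  simp only [map_add, map_smul, fderiv_act_fieldS hs, fderiv_act_fieldE _ hs, ds_fieldS s hs g,
    ds_fieldE _ s hs g, sigma_fieldS _ s hs g, sigma_fieldE _ _ s hs g]
  simp

end TwoVortex

theorem proposition3p1 (γ : ℂ × ℂ → (ℂ × ℂ →L[ℝ] ℂ × ℂ →L[ℝ] ℝ))
    (hK : TwoVortex.IsKahlerMetric γ) (hG : TwoVortex.IsMobiusInvariant γ)
    (hP : TwoVortex.IsSwapInvariant γ) :
    ∃ A : ℝ → ℝ, ContDiffOn ℝ ∞ A (Ioi 0) ∧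
      ∃ A₁ A₂ A₃ A₄ : ℝ → ℝ,
        (∀ s : ℝ, 0 < s →
          A₁ s = 1 / (8 * Real.sinh (s / 2)) * deriv (fun t => A t / Real.cosh (t / 2)) s ∧
          A₂ s = A s ∧
          A₃ s = 2 * Real.sinh (s / 2) * deriv (fun t => A t / Real.cosh (t / 2)) s ∧
          A₄ s = A s / Real.cosh (s / 2) ^ 2) ∧
        ∀ p ∈ TwoVortex.space, ∀ u v : ℂ × ℂ,
          γ p u v =
            A₁ (TwoVortex.sep p) * (TwoVortex.ds p u * TwoVortex.ds p v) +
            A₂ (TwoVortex.sep p) * (TwoVortex.sigma 0 p u * TwoVortex.sigma 0 p v) +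
            A₃ (TwoVortex.sep p) * (TwoVortex.sigma 1 p u * TwoVortex.sigma 1 p v) +
            A₄ (TwoVortex.sep p) * (TwoVortex.sigma 2 p u * TwoVortex.sigma 2 p v) := by
  -- The requirement `A₂ = A` leaves no choice: `A` is the coefficient of `σ₁²`.
  refine ⟨fun s => 4 * Real.cosh (s / 2) ^ 2 * TwoVortex.evenCoeff γ s, ?_,
    fun s => TwoVortex.oddCoeff γ s / 4,
    fun s => 4 * Real.cosh (s / 2) ^ 2 * TwoVortex.evenCoeff γ s,
    fun s => 4 * Real.sinh (s / 2) ^ 2 * TwoVortex.oddCoeff γ s,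
    fun s => 4 * TwoVortex.evenCoeff γ s, fun s hs => ?_,
    fun p hp u v => TwoVortex.apply_eq hK hG hP hp u v⟩
  · have : ContDiff ℝ ∞ fun s : ℝ => 4 * Real.cosh (s / 2) ^ 2 :=
      contDiff_const.mul ((Real.contDiff_cosh.comp (by fun_prop)).pow 2)
    exact this.contDiffOn.mul (TwoVortex.contDiffOn_evenCoeff hK)
  · have hsh : 0 < Real.sinh (s / 2) := Real.sinh_pos_iff.2 (by positivity)
    have hch : ∀ t : ℝ, Real.cosh t ≠ 0 := fun t => (Real.cosh_pos t).ne'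
    -- The quotient is `4 cosh(t/2) * evenCoeff γ t`, and its derivative is twice the right side of
    -- `oddCoeff_mul_sinh`. Both `A₁` and `A₃` follow from this one value.
    have hd : deriv (fun t => 4 * Real.cosh (t / 2) ^ 2 * TwoVortex.evenCoeff γ t /
        Real.cosh (t / 2)) s = 2 * Real.sinh (s / 2) * TwoVortex.oddCoeff γ s := by
      have h1 : (fun t => 4 * Real.cosh (t / 2) ^ 2 * TwoVortex.evenCoeff γ t /
          Real.cosh (t / 2)) = fun t => 4 * Real.cosh (t / 2) * TwoVortex.evenCoeff γ t := by
        funext t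
        have := hch (t / 2)
        field_simp
      have h2 : HasDerivAt (fun t : ℝ => 4 * Real.cosh (t / 2))
          (4 * (Real.sinh (s / 2) * (1 / 2))) s :=
        ((hasDerivAt_id s).div_const 2).cosh.const_mul 4
      rw [h1]
      refine (h2.mul (TwoVortex.differentiableAt_evenCoeff hK hs).hasDerivAt).deriv.trans ?_
      linear_combination -2 * TwoVortex.oddCoeff_mul_sinh hK hG hP hs
    rw [hd]
    refine ⟨?_, rfl, ?_, ?_⟩
    · field_simp
      ring
    · ring
    · have := hch (s / 2)
      field_simp
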